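/- Let $n \ge 2$ and let $\mathbb{L}^n = \{x \in \mathbb{R}^n \mid x_1 \ge \sqrt{x_2^2 + \cdots + x_n^2}\}$ be the second-order cone, with boundary $\partial\mathbb{L}^n$. Let $\mathbb{S}^n$ be the space of real symmetric $n \times n$ matrices with the inner product $\langle A, B\rangle = \sum_{i,j} A_{ij}B_{ij}$, let $\mathcal{COP}(\mathbb{L}^n) = \{A \in \mathbb{S}^n \mid x^\top A x \ge 0 \text{ for all } x \in \mathbb{L}^n\}$ be the copositive cone over $\mathbb{L}^n$, and let $J_n = \mathrm{diag}(1, -1, \dots, -1) \in \mathbb{S}^n$. For an element $X$ of a real vector space, $\mathbb{R}_+X = \{\alpha X \mid \alpha \ge 0\}$. A face of a closed convex cone $K$ is a nonempty convex subcone $F \subseteq K$ such that $a, b \in K$ and $a + b \in F$ imply $a, b \in F$. An extreme ray of $K$ is a face whose linear span is one-dimensional. A face $F$ of $K$ is exposed if $F = \{H\}^\perp \cap K$ for some $H$ in the dual cone $K^*$. Every extreme ray of $\mathcal{COP}(\mathbb{L}^n)$ falls into one of the following three families: (i) $\mathbb{R}_+xx^\top$ with $x \in \mathbb{R}^n \setminus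 (\mathbb{L}^n \cup (-\mathbb{L}^n))$; (ii) $\mathbb{R}_+J_n$; (iii) $\mathbb{R}_+xx^\top$ with $x \in \partial\mathbb{L}^n \setminus \{0\}$. Conversely, all the rays of the form (i), (ii) or (iii) are extreme rays of $\mathcal{COP}(\mathbb{L}^n)$. Furthermore, the rays in (i) and (ii) are exposed faces of $\mathcal{COP}(\mathbb{L}^n)$, and no ray in (iii) is. -/

import Mathlib

open scoped Pointwise

/-! ### Cones, faces and exposed faces -/

section Cones

variable {V : Type*} [AddCommGroup V] [Module ℝ V]

/-- The half-line `ℝ₊ x = {α x | α ≥ 0}` as a convex cone. -/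
def rayCone (x : V) : PointedCone ℝ V where
  carrier := {y | ∃ α : ℝ, 0 ≤ α ∧ y = α • x}
  add_mem' := by
    rintro a b ⟨α, hα, rfl⟩ ⟨β, hβ, rfl⟩
    exact ⟨α + β, add_nonneg hα hβ, (add_smul α β x).symm⟩
  zero_mem' := ⟨0, le_rfl, (zero_smul ℝ x).symm⟩
  smul_mem' := by
    rintro ⟨c, hc⟩ y ⟨α, hα, rfl⟩
    exact ⟨c * α, mul_nonneg hc hα, (mul_smul c α x).symm⟩

/-- The dimension of a cone: the dimension of its linear span. -/
noncomputable def coneDim (F : PointedCone ℝ V) : ℕ :=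
  Module.finrank ℝ (Submodule.span ℝ (F : Set V))

/-- An extreme ray of a convex cone `K` is a one-dimensional face of `K`. -/
def IsExtremeRay (F K : PointedCone ℝ V) : Prop :=
  F.IsFaceOf K ∧ coneDim F = 1

/-- A face `F` of `K` is exposed if `F = {x}^⊥ ∩ K` for some `x` in the dual cone `K^*`. Here `p`
is the inner product of the ambient space. -/
def IsExposedFace (p : V →ₗ[ℝ] V →ₗ[ℝ] ℝ) (F K : PointedCone ℝ V) : Prop :=
  F.IsFaceOf K ∧
    ∃ x ∈ PointedCone.dual p (K : Set V), (F : Set V) = {y | p x y = 0} ∩ (K : Set V)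

end Cones

/-! ### Symmetric matrices -/

/-- The space `𝕊ⁿ` of real symmetric `n × n` matrices. -/
def symMat (n : ℕ) : Submodule ℝ (Matrix (Fin n) (Fin n) ℝ) where
  carrier := {A | A.IsSymm}
  add_mem' := fun hA hB => Matrix.IsSymm.add hA hB
  zero_mem' := Matrix.isSymm_zero
  smul_mem' := fun c _ hA => Matrix.IsSymm.smul hA c

/-- The inner product `⟨A, B⟩ = ∑ i j, A i j * B i j` on `𝕊ⁿ`. -/
def symInner (n : ℕ) : symMat n →ₗ[ℝ] symMat n →ₗ[ℝ] ℝ :=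
  LinearMap.mk₂ ℝ (fun A B => ∑ i, ∑ j, A.1 i j * B.1 i j)
    (by intro A A' B; simp [add_mul, Finset.sum_add_distrib])
    (by intro c A B; simp [Finset.mul_sum, mul_assoc])
    (by intro A B B'; simp [mul_add, Finset.sum_add_distrib])
    (by intro c A B; simp [Finset.mul_sum, mul_left_comm])

/-- The symmetric matrix `x xᵀ`. -/
def symSquare {n : ℕ} (x : Fin n → ℝ) : symMat n :=
  ⟨Matrix.vecMulVec x x, by
    change (Matrix.vecMulVec x x).IsSymm
    ext i j
    simp [Matrix.vecMulVec_apply, mul_comm]⟩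

/-- The diagonal matrix `J` of size `m + 1` with diagonal `(1, -1, …, -1)`. -/
def symJ (m : ℕ) : symMat (m + 1) :=
  ⟨Matrix.diagonal (Fin.cons 1 (fun _ => -1)), Matrix.isSymm_diagonal _⟩

/-! ### The second-order cone and copositive cones -/

/-- The second-order cone of dimension `n = m + 1`: the vectors of `ℝⁿ` whose first coordinate is at
least the Euclidean norm of the vector of the other `m` coordinates. (Only the topology of
`Fin (m + 1) → ℝ` is used, which is the Euclidean one; the norm is written out.) -/
def secondOrderCone (m : ℕ) : Set (Fin (m + 1) → ℝ) :=
  {x | √(∑ i : Fin m, x i.succ ^ 2) ≤ x 0}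

/-- The copositive cone over `K`: the symmetric matrices `A` with `xᵀ A x ≥ 0` for all `x ∈ K`. -/
def copositiveCone {n : ℕ} (K : Set (Fin n → ℝ)) : PointedCone ℝ (symMat n) where
  carrier := {A | ∀ x ∈ K, 0 ≤ x ⬝ᵥ A.1.mulVec x}
  add_mem' := by
    intro A B hA hB x hx
    simpa [Matrix.add_mulVec, dotProduct_add] using add_nonneg (hA x hx) (hB x hx)
  zero_mem' := by intro x _; simp
  smul_mem' := by
    rintro ⟨c, hc⟩ A hA x hx
    have h : ((⟨c, hc⟩ : {c : ℝ // 0 ≤ c}) • A).1 = c • A.1 := rfl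
    simpa [h, Matrix.smul_mulVec, dotProduct_smul] using mul_nonneg hc (hA x hx)

/-!
By the S-lemma, a matrix is copositive over the second-order cone if and only if it is `t J + P`
with `t ≥ 0` and `P` positive semidefinite, so the copositive cone is generated by `J` and the
squares `x xᵀ`, and only the rays through these generators can be extreme. Let `q x = xᵀ J x`. The
reversed Cauchy–Schwarz inequality makes `x xᵀ - q x • J` copositive, which rules out `x xᵀ` with
`q x > 0`.

A matrix exposes a generator as soon as it is nonnegative on all generators and vanishes on no other
ray: `diag(m, 1, …, 1)` does so for `J`, and if `q x < 0`, then `r y yᵀ + (|x|² I - x xᵀ)` with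
`y ⊥ x`, `q y > 0` and `r` large does so for `x xᵀ`.

For `q x = 0` everything rests on one fact: if `M y = 0` for some null vector `y ≠ 0` and `M - t J`
is positive semidefinite, then the quadratic form of `M - t J` vanishes at `y`, so `t J y = 0` and
`t = 0`. With `M = c x xᵀ` and `y = J x` it shows that the ray of `x xᵀ` is a face. A matrix `M`
exposing that ray would satisfy `M x = 0` and, being in the dual cone, `M - ⟨M, J⟩ J ⪰ 0`; hence
`⟨M, J⟩ = 0`, so `M` would also vanish on `J`.
-/

section Cones

variable {V : Type*} [AddCommGroup V] [Module ℝ V]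

theorem self_mem_rayCone (x : V) : x ∈ rayCone x := ⟨1, zero_le_one, (one_smul ℝ x).symm⟩

theorem rayCone_le_iff {x : V} {K : PointedCone ℝ V} : rayCone x ≤ K ↔ x ∈ K := by
  refine ⟨fun h => h (self_mem_rayCone x), ?_⟩
  rintro hx _ ⟨α, hα, rfl⟩
  exact K.smul_mem hα hx

theorem rayCone_eq_hull (x : V) : rayCone x = PointedCone.hull ℝ {x} :=
  le_antisymm (rayCone_le_iff.2 (Submodule.mem_span_singleton_self x))
    (Submodule.span_le.2 (Set.singleton_subset_iff.2 (self_mem_rayCone x)))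

theorem coneDim_rayCone {x : V} (hx : x ≠ 0) : coneDim (rayCone x) = 1 := by
  have hspan : Submodule.span ℝ (rayCone x : Set V) = Submodule.span ℝ {x} := by
    refine le_antisymm (Submodule.span_le.2 ?_)
      (Submodule.span_mono (Set.singleton_subset_iff.2 (self_mem_rayCone x)))
    rintro _ ⟨α, -, rfl⟩
    exact Submodule.smul_mem _ _ (Submodule.mem_span_singleton_self x)
  rw [coneDim, hspan, finrank_span_singleton hx]

theorem apply_nonneg_of_mem_hull {S : Set V} {ℓ : V →ₗ[ℝ] ℝ} (hℓ : ∀ s ∈ S, 0 ≤ ℓ s) {x : V}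
    (hx : x ∈ PointedCone.hull ℝ S) : 0 ≤ ℓ x := by
  have hle : PointedCone.hull ℝ S ≤ (PointedCone.positive ℝ ℝ).comap ℓ := Submodule.span_le.2 hℓ
  exact hle hx

theorem mem_of_mem_hull_of_apply_eq_zero {S : Set V} {F : PointedCone ℝ V} {ℓ : V →ₗ[ℝ] ℝ}
    (hℓ : ∀ s ∈ S, 0 ≤ ℓ s) (hF : ∀ s ∈ S, ℓ s = 0 → s ∈ F) {x : V}
    (hx : x ∈ PointedCone.hull ℝ S) (hx0 : ℓ x = 0) : x ∈ F := by
  induction hx using Submodule.span_induction with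
  | mem s hs => exact hF s hs hx0
  | zero => exact F.zero_mem
  | add y z hy hz ihy ihz =>
    rw [map_add, add_eq_zero_iff_of_nonneg (apply_nonneg_of_mem_hull hℓ hy)
      (apply_nonneg_of_mem_hull hℓ hz)] at hx0
    exact F.add_mem (ihy hx0.1) (ihz hx0.2)
  | smul c y _ ih =>
    change ℓ ((c : ℝ) • y) = 0 at hx0
    rw [map_smul, smul_eq_zero] at hx0
    rcases hx0 with hc | hy
    · rw [show c = 0 from Subtype.ext hc, zero_smul]
      exact F.zero_mem
    · exact F.smul_mem c.2 (ih hy)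

theorem lineal_hull_eq_bot {S : Set V} {ℓ : V →ₗ[ℝ] ℝ} (hℓ : ∀ s ∈ S, s ≠ 0 → 0 < ℓ s) :
    (PointedCone.hull ℝ S).lineal = ⊥ := by
  have hnonneg : ∀ s ∈ S, 0 ≤ ℓ s := fun s hs => by
    rcases eq_or_ne s 0 with rfl | hs0
    · rw [map_zero]
    · exact (hℓ s hs hs0).le
  refine (Submodule.eq_bot_iff _).2 fun x hx => ?_
  have hx0 : ℓ x = 0 := by
    have hneg := apply_nonneg_of_mem_hull hnonneg hx.2
    rw [map_neg, Left.nonneg_neg_iff] at hneg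
    exact hneg.antisymm (apply_nonneg_of_mem_hull hnonneg hx.1)
  have hmem : x ∈ (⊥ : PointedCone ℝ V) := mem_of_mem_hull_of_apply_eq_zero hnonneg
    (fun s hs hs0 => by_contra fun hne => (hℓ s hs hne).ne' hs0) hx.1 hx0
  exact hmem

theorem isExposedFace_of_forall_mem_iff {p : V →ₗ[ℝ] V →ₗ[ℝ] ℝ} (hp : p.IsSymm)
    {F K : PointedCone ℝ V} {H : V} (hH : ∀ x ∈ K, 0 ≤ p H x)
    (hF : ∀ x, x ∈ F ↔ p H x = 0 ∧ x ∈ K) : IsExposedFace p F K := by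
  refine ⟨.of_mem_of_add_mem_left (fun x hx => ((hF x).1 hx).2) ?_, H, ?_, Set.ext hF⟩
  · intro x y hx hy hxy
    have hsum := ((hF _).1 hxy).1
    rw [map_add, add_eq_zero_iff_of_nonneg (hH x hx) (hH y hy)] at hsum
    exact (hF x).2 ⟨hsum.1, hx⟩
  · intro x hx
    rw [← hp.eq H x]
    exact hH x hx

theorem isExposedFace_rayCone_hull {p : V →ₗ[ℝ] V →ₗ[ℝ] ℝ} (hp : p.IsSymm) {S : Set V} {g H : V}
    (hg : g ∈ S) (hHg : p H g = 0) (hnonneg : ∀ s ∈ S, 0 ≤ p H s)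
    (hzero : ∀ s ∈ S, p H s = 0 → s ∈ rayCone g) :
    IsExposedFace p (rayCone g) (PointedCone.hull ℝ S) := by
  refine isExposedFace_of_forall_mem_iff hp (fun x => apply_nonneg_of_mem_hull hnonneg)
    fun x => ⟨fun hx => ⟨?_, rayCone_le_iff.2 (Submodule.subset_span hg) hx⟩,
      fun hx => mem_of_mem_hull_of_apply_eq_zero hnonneg hzero hx.2 hx.1⟩
  obtain ⟨α, -, rfl⟩ := hx
  rw [map_smul, hHg, smul_zero]

theorem isFaceOf_rayCone_sup {F L : PointedCone ℝ V} {g : V} (hF : F.IsFaceOf L)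
    (hg : ∀ t : ℝ, 0 ≤ t → ∀ x ∈ L, t • g + x ∈ F → t = 0) : F.IsFaceOf (rayCone g ⊔ L) := by
  refine .of_mem_of_add_mem_left (hF.le.trans le_sup_right) fun hA hB hxy => ?_
  obtain ⟨_, ⟨t, ht, rfl⟩, x, hx, rfl⟩ := Submodule.mem_sup.1 hA
  obtain ⟨_, ⟨s, hs, rfl⟩, y, hy, rfl⟩ := Submodule.mem_sup.1 hB
  rw [add_add_add_comm, ← add_smul] at hxy
  have hts := hg _ (add_nonneg ht hs) _ (L.add_mem hx hy) hxy
  have ht0 : t = 0 := by linarith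
  rw [hts, zero_smul, zero_add] at hxy
  rw [ht0, zero_smul, zero_add]
  exact hF.mem_of_add_mem_left hx hy hxy

theorem isExtremeRay_rayCone {x : V} {K : PointedCone ℝ V} (hface : (rayCone x).IsFaceOf K)
    (hx : x ≠ 0) : IsExtremeRay (rayCone x) K :=
  ⟨hface, coneDim_rayCone hx⟩

theorem IsExtremeRay.eq_rayCone {R K : PointedCone ℝ V} (hR : IsExtremeRay R K)
    (hK : K.lineal = ⊥) {x : V} (hx : x ∈ R) (hx0 : x ≠ 0) : R = rayCone x := by
  refine le_antisymm (fun y hy => ?_) (rayCone_le_iff.2 hx)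
  obtain ⟨c, hc⟩ := (finrank_eq_one_iff_of_nonzero'
    (⟨x, Submodule.subset_span hx⟩ : Submodule.span ℝ (R : Set V)) (by simpa using hx0)).1 hR.2
    ⟨y, Submodule.subset_span hy⟩
  have hcy : c • x = y := congrArg Subtype.val hc
  refine ⟨c, ?_, hcy.symm⟩
  by_contra! hneg
  have hnegx : -x = (-c)⁻¹ • y := by
    rw [← hcy, smul_smul, inv_neg, neg_mul, inv_mul_cancel₀ hneg.ne, neg_one_smul]
  have hlineal : x ∈ K.lineal :=
    ⟨hR.1.le hx, hR.1.le (hnegx ▸ R.smul_mem (inv_nonneg.2 (neg_nonneg.2 hneg.le)) hy)⟩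
  rw [hK] at hlineal
  exact hx0 hlineal

theorem IsExtremeRay.exists_ne_zero {R K : PointedCone ℝ V} (hR : IsExtremeRay R K) :
    ∃ x ∈ R, x ≠ 0 := by
  by_contra! h
  have hdim := hR.2
  rw [coneDim, Submodule.span_eq_bot.2 h, finrank_bot] at hdim
  exact zero_ne_one hdim

theorem exists_ne_zero_generator_mem_of_isFaceOf_hull {F : PointedCone ℝ V} {S : Set V}
    (hF : F.IsFaceOf (PointedCone.hull ℝ S)) {x : V} (hx : x ∈ F) (hx0 : x ≠ 0) :
    ∃ s ∈ S, s ∈ F ∧ s ≠ 0 := by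
  have hxS := hF.le hx
  induction hxS using Submodule.span_induction with
  | mem s hs => exact ⟨s, hs, hx, hx0⟩
  | zero => exact absurd rfl hx0
  | add y z hy hz ihy ihz =>
    obtain ⟨hyF, hzF⟩ := (hF.add_mem_iff_mem hy hz).1 hx
    rcases eq_or_ne y 0 with rfl | hy0
    · exact ihz hzF (by simpa using hx0)
    · exact ihy hyF hy0
  | smul c y hy ih =>
    have hc : 0 < c := pos_of_ne_zero (left_ne_zero_of_smul hx0)
    exact ih (hF.mem_of_smul_add_mem hy (Submodule.zero_mem _) hc (by rwa [add_zero]))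
      (right_ne_zero_of_smul hx0)

end Cones

section SLemma

theorem exists_roots_of_mul_neg {a b c : ℝ} (hac : a * c < 0) :
    ∃ s t : ℝ, s < 0 ∧ 0 < t ∧ s * t * a = c ∧
      a * s ^ 2 + b * s + c = 0 ∧ a * t ^ 2 + b * t + c = 0 := by
  have ha : a ≠ 0 := left_ne_zero_of_mul hac.ne
  have hc : c ≠ 0 := right_ne_zero_of_mul hac.ne
  obtain ⟨x, hx⟩ : ∃ x, a * x ^ 2 + b * x + c = 0 := by
    have hdiscrim : 0 ≤ discrim a b c := by
      rw [discrim]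
      nlinarith [sq_nonneg b]
    simpa only [sq] using
      exists_quadratic_eq_zero ha ⟨_, (Real.mul_self_sqrt hdiscrim).symm⟩
  have hx0 : x ≠ 0 := by
    rintro rfl
    simp [hc] at hx
  obtain ⟨y, hy⟩ : ∃ y, x * y * a = c := ⟨c / (a * x), by field_simp⟩
  have hyroot : a * y ^ 2 + b * y + c = 0 := by
    have h : x * (a * y ^ 2 + b * y + c) = 0 := by
      linear_combination y * hx + (y - x) * hy
    exact (mul_eq_zero.1 h).resolve_left hx0
  have hxy : x * y < 0 := by
    have h : (x * y) * a ^ 2 < 0 := by linear_combination hac + a * hy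
    exact neg_of_mul_neg_left h (sq_nonneg a)
  rcases mul_neg_iff.1 hxy with ⟨hxpos, hyneg⟩ | ⟨hxneg, hypos⟩
  · exact ⟨y, x, hyneg, hxpos, by rw [mul_comm y, hy], hyroot, hx⟩
  · exact ⟨x, y, hxneg, hypos, hy, hx, hyroot⟩

variable {V : Type*} [AddCommGroup V] [Module ℝ V] {f g : QuadraticForm ℝ V}

theorem quadraticForm_add_smul (f : QuadraticForm ℝ V) (x y : V) (s : ℝ) :
    f (x + s • y) = f y * s ^ 2 + QuadraticMap.polar f x y * s + f x := by
  rw [QuadraticMap.map_add f, QuadraticMap.map_smul, QuadraticMap.polar_smul_right, smul_eq_mul,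
    smul_eq_mul]
  ring

/- The line through `x` in direction `y` meets `{g = 0}` at parameters `s < 0 < t`; weighting the
inequalities for `f` at these two points by `t` and `-s` cancels the polar term. -/
theorem mul_le_mul_of_forall_nonneg_imp_nonneg (h : ∀ x, 0 ≤ g x → 0 ≤ f x) {x y : V}
    (hx : 0 < g x) (hy : g y < 0) : f x * g y ≤ f y * g x := by
  obtain ⟨s, t, hs, ht, hst, hgs, hgt⟩ :=
    exists_roots_of_mul_neg (b := QuadraticMap.polar g x y) (mul_neg_of_neg_of_pos hy hx)
  have hfs := h (x + s • y) (by rw [quadraticForm_add_smul, hgs])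
  have hft := h (x + t • y) (by rw [quadraticForm_add_smul, hgt])
  rw [quadraticForm_add_smul] at hfs hft
  have hweighted : 0 ≤ (t - s) * (f x - s * t * f y) := by
    linear_combination mul_nonneg ht.le hfs + mul_nonneg (neg_nonneg.2 hs.le) hft
  have hle : s * t * f y ≤ f x :=
    sub_nonneg.1 (nonneg_of_mul_nonneg_right hweighted (by linarith))
  calc f x * g y ≤ s * t * f y * g y := mul_le_mul_of_nonpos_right hle hy.le
    _ = f y * g x := by rw [← hst]; ring

theorem exists_forall_mul_le_of_forall_nonneg_imp_nonneg (hg : ∃ x, 0 < g x)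
    (h : ∀ x, 0 ≤ g x → 0 ≤ f x) : ∃ t : ℝ, 0 ≤ t ∧ ∀ x, t * g x ≤ f x := by
  set S : Set ℝ := insert 0 {r | ∃ y, g y < 0 ∧ r = f y / g y}
  have hupper : ∀ x, 0 < g x → f x / g x ∈ upperBounds S := by
    rintro x hx r (rfl | ⟨y, hy, rfl⟩)
    · exact div_nonneg (h x hx.le) hx.le
    · rw [div_le_iff_of_neg hy, div_mul_eq_mul_div, div_le_iff₀ hx]
      exact mul_le_mul_of_forall_nonneg_imp_nonneg h hx hy
  obtain ⟨x₀, hx₀⟩ := hg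
  have hS : BddAbove S := ⟨_, hupper x₀ hx₀⟩
  refine ⟨sSup S, le_csSup hS (Set.mem_insert _ _), fun x => ?_⟩
  rcases lt_trichotomy (g x) 0 with hx | hx | hx
  · rw [← div_le_iff_of_neg hx]
    exact le_csSup hS (Set.mem_insert_of_mem _ ⟨x, hx, rfl⟩)
  · rw [hx, mul_zero]
    exact h x hx.ge
  · rw [← le_div_iff₀ hx]
    exact csSup_le ⟨0, Set.mem_insert _ _⟩ (hupper x hx)

end SLemma

section SymMat

open Matrix

variable {n : ℕ}

theorem symInner_isSymm : (symInner n).IsSymm :=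
  ⟨fun A B => by simp [symInner, mul_comm]⟩

theorem symInner_symSquare (A : symMat n) (x : Fin n → ℝ) :
    symInner n A (symSquare x) = x ⬝ᵥ A.1 *ᵥ x := by
  simp only [symInner, LinearMap.mk₂_apply, symSquare, vecMulVec_apply, dotProduct, mulVec,
    Finset.mul_sum]
  exact Finset.sum_congr rfl fun i _ => Finset.sum_congr rfl fun j _ => by ring

theorem symSquare_mulVec (x y : Fin n → ℝ) : (symSquare x).1 *ᵥ y = (x ⬝ᵥ y) • x := by
  simp [symSquare, vecMulVec_mulVec]

theorem dotProduct_symSquare_mulVec (x y : Fin n → ℝ) :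
    y ⬝ᵥ (symSquare x).1 *ᵥ y = (x ⬝ᵥ y) ^ 2 := by
  rw [symSquare_mulVec, dotProduct_smul, smul_eq_mul, dotProduct_comm y, sq]

theorem symSquare_zero : symSquare (0 : Fin n → ℝ) = 0 := by
  ext i j
  simp [symSquare]

theorem symSquare_ne_zero {x : Fin n → ℝ} (hx : x ≠ 0) : symSquare x ≠ 0 := by
  intro h
  have hxx := dotProduct_symSquare_mulVec x x
  rw [h] at hxx
  exact hx (by simpa [eq_comm (a := (0 : ℝ))] using hxx)

theorem symSquare_neg (x : Fin n → ℝ) : symSquare (-x) = symSquare x := by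
  ext i j
  simp [symSquare, vecMulVec_apply]

theorem symSquare_smul (c : ℝ) (x : Fin n → ℝ) : symSquare (c • x) = c ^ 2 • symSquare x := by
  ext i j
  simp only [symSquare, SetLike.val_smul, Matrix.smul_apply, vecMulVec_apply, Pi.smul_apply,
    smul_eq_mul]
  ring

theorem symSquare_mem_copositiveCone (K : Set (Fin n → ℝ)) (x : Fin n → ℝ) :
    symSquare x ∈ copositiveCone K := by
  intro y _
  rw [dotProduct_symSquare_mulVec]
  positivity

theorem copositiveCone_anti {K L : Set (Fin n → ℝ)} (h : K ⊆ L) :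
    copositiveCone L ≤ copositiveCone K :=
  fun _ hA x hx => hA x (h hx)

theorem mem_copositiveCone_univ_iff_posSemidef {A : symMat n} :
    A ∈ copositiveCone Set.univ ↔ A.1.PosSemidef := by
  refine ⟨fun hA => .of_dotProduct_mulVec_nonneg A.2 fun x => ?_,
    fun hA x _ => by simpa using hA.dotProduct_mulVec_nonneg x⟩
  simpa using hA x (Set.mem_univ x)

theorem copositiveCone_univ_eq_hull :
    copositiveCone (Set.univ : Set (Fin n → ℝ)) = PointedCone.hull ℝ (Set.range symSquare) := by
  refine le_antisymm (fun A hA => ?_)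
    (Submodule.span_le.2 (Set.range_subset_iff.2 (symSquare_mem_copositiveCone _)))
  obtain ⟨k, v, hv⟩ :=
    posSemidef_iff_eq_sum_vecMulVec.1 (mem_copositiveCone_univ_iff_posSemidef.1 hA)
  have hsum : A = ∑ i, symSquare (v i) := Subtype.ext <| by
    rw [hv, AddSubmonoidClass.coe_finsetSum]
    rfl
  rw [hsum]
  exact Submodule.sum_mem _ fun i _ => Submodule.subset_span (Set.mem_range_self (v i))

theorem mulVec_eq_zero_of_mem_copositiveCone_univ {A : symMat n}
    (hA : A ∈ copositiveCone Set.univ) {x : Fin n → ℝ} (hx : x ⬝ᵥ A.1 *ᵥ x = 0) :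
    A.1 *ᵥ x = 0 :=
  ((mem_copositiveCone_univ_iff_posSemidef.1 hA).dotProduct_mulVec_zero_iff x).1 (by simpa using hx)

/-- The matrix `|x|² I - x xᵀ`, which is `|x|²` times the orthogonal projection onto the complement
of `x`. It exposes the ray of `x xᵀ` in the cone of positive semidefinite matrices. -/
def orthProjMat (x : Fin n → ℝ) : symMat n :=
  (x ⬝ᵥ x) • ⟨1, isSymm_one⟩ - symSquare x

theorem symInner_orthProjMat_symSquare (x v : Fin n → ℝ) :
    symInner n (orthProjMat x) (symSquare v) = (x ⬝ᵥ x) * (v ⬝ᵥ v) - (x ⬝ᵥ v) ^ 2 := by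
  simp [orthProjMat, symInner_symSquare, dotProduct_symSquare_mulVec]

theorem symInner_orthProjMat_symSquare_self (x : Fin n → ℝ) :
    symInner n (orthProjMat x) (symSquare x) = 0 := by
  rw [symInner_orthProjMat_symSquare, sq, sub_self]

theorem symInner_orthProjMat_symSquare_nonneg (x v : Fin n → ℝ) :
    0 ≤ symInner n (orthProjMat x) (symSquare v) := by
  rw [symInner_orthProjMat_symSquare, sub_nonneg]
  simpa [dotProduct, sq] using Finset.sum_mul_sq_le_sq_mul_sq Finset.univ x v

theorem symSquare_mem_rayCone_of_symInner_orthProjMat_eq_zero {x v : Fin n → ℝ} (hx : x ≠ 0)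
    (h : symInner n (orthProjMat x) (symSquare v) = 0) : symSquare v ∈ rayCone (symSquare x) := by
  have hxx : x ⬝ᵥ x ≠ 0 := by simpa using hx
  rw [symInner_orthProjMat_symSquare] at h
  have hv : v - (x ⬝ᵥ v / x ⬝ᵥ x) • x = 0 := by
    rw [← dotProduct_self_eq_zero]
    simp only [sub_dotProduct, dotProduct_sub, smul_dotProduct, dotProduct_smul, smul_eq_mul,
      dotProduct_comm v x]
    field_simp
    linear_combination h
  rw [sub_eq_zero.1 hv, symSquare_smul]
  exact ⟨_, sq_nonneg _, rfl⟩

theorem isExposedFace_rayCone_symSquare_copositiveCone_univ {x : Fin n → ℝ} (hx : x ≠ 0) :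
    IsExposedFace (symInner n) (rayCone (symSquare x)) (copositiveCone Set.univ) := by
  rw [copositiveCone_univ_eq_hull]
  refine isExposedFace_rayCone_hull symInner_isSymm (Set.mem_range_self x)
    (symInner_orthProjMat_symSquare_self x) ?_ ?_
  · rintro _ ⟨v, rfl⟩
    exact symInner_orthProjMat_symSquare_nonneg x v
  · rintro _ ⟨v, rfl⟩ hv
    exact symSquare_mem_rayCone_of_symInner_orthProjMat_eq_zero hx hv

end SymMat

section Lorentz

open Matrix

variable {m : ℕ} {x : Fin (m + 1) → ℝ}

/-- The Lorentz form `x₀² - x₁² - ⋯ - xₘ²`, the quadratic form of `J`. -/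
def lorentzForm (x : Fin (m + 1) → ℝ) : ℝ := x 0 ^ 2 - ∑ i : Fin m, x i.succ ^ 2

theorem dotProduct_symJ_mulVec (x : Fin (m + 1) → ℝ) :
    x ⬝ᵥ (symJ m).1 *ᵥ x = lorentzForm x := by
  simp [symJ, mulVec_diagonal, dotProduct, lorentzForm, Fin.sum_univ_succ, sq, sub_eq_add_neg]

theorem symJ_mulVec_symJ_mulVec (x : Fin (m + 1) → ℝ) :
    (symJ m).1 *ᵥ ((symJ m).1 *ᵥ x) = x := by
  ext i
  cases i using Fin.cases <;> simp [symJ, mulVec_diagonal]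

theorem symJ_mulVec_ne_zero (hx : x ≠ 0) : (symJ m).1 *ᵥ x ≠ 0 := fun h =>
  hx (by rw [← symJ_mulVec_symJ_mulVec x, h, mulVec_zero])

theorem lorentzForm_symJ_mulVec (x : Fin (m + 1) → ℝ) :
    lorentzForm ((symJ m).1 *ᵥ x) = lorentzForm x := by
  rw [← dotProduct_symJ_mulVec, symJ_mulVec_symJ_mulVec, dotProduct_comm, dotProduct_symJ_mulVec]

theorem symJ_ne_zero : symJ m ≠ 0 := by
  intro h
  have h00 := congrArg (fun A : symMat (m + 1) => A.1 0 0) h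
  simp [symJ] at h00

theorem lorentzForm_zero : lorentzForm (0 : Fin (m + 1) → ℝ) = 0 := by
  simp [lorentzForm]

theorem lorentzForm_neg (x : Fin (m + 1) → ℝ) : lorentzForm (-x) = lorentzForm x := by
  simp [lorentzForm]

/- The combination `x 0 • u - u 0 • J x` has vanishing first coordinate, so its Lorentz form is
nonpositive. -/
theorem lorentzForm_mul_le_dotProduct_sq {u : Fin (m + 1) → ℝ} (hu : 0 ≤ lorentzForm u)
    (x : Fin (m + 1) → ℝ) : lorentzForm u * lorentzForm x ≤ (u ⬝ᵥ x) ^ 2 := by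
  rcases hu.eq_or_lt with hu | hu
  · rw [← hu, zero_mul]
    positivity
  have hu0 : 0 < u 0 ^ 2 :=
    hu.trans_le (sub_le_self _ (Finset.sum_nonneg fun i _ => sq_nonneg (u i.succ)))
  have hcomb : x 0 ^ 2 * lorentzForm u - 2 * (x 0 * u 0) * (u ⬝ᵥ x) +
      u 0 ^ 2 * lorentzForm x = -∑ i : Fin m, (x 0 * u i.succ + u 0 * x i.succ) ^ 2 := by
    have hexpand : ∑ i : Fin m, (x 0 * u i.succ + u 0 * x i.succ) ^ 2 =
        x 0 ^ 2 * ∑ i : Fin m, u i.succ ^ 2 +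
          2 * (x 0 * u 0) * ∑ i : Fin m, u i.succ * x i.succ +
          u 0 ^ 2 * ∑ i : Fin m, x i.succ ^ 2 := by
      simp only [Finset.mul_sum, ← Finset.sum_add_distrib]
      exact Finset.sum_congr rfl fun i _ => by ring
    rw [hexpand, lorentzForm, lorentzForm, dotProduct, Fin.sum_univ_succ]
    ring
  have hnonpos : x 0 ^ 2 * lorentzForm u - 2 * (x 0 * u 0) * (u ⬝ᵥ x) +
      u 0 ^ 2 * lorentzForm x ≤ 0 :=
    hcomb.trans_le (neg_nonpos.2 (Finset.sum_nonneg fun i _ => sq_nonneg _))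
  refine le_of_mul_le_mul_left ?_ hu0
  linear_combination lorentzForm u * hnonpos + sq_nonneg (x 0 * lorentzForm u - u 0 * (u ⬝ᵥ x))

theorem exists_lorentzForm_pos_of_lorentzForm_neg (hx : lorentzForm x < 0) :
    ∃ y, 0 < lorentzForm y ∧ y ⬝ᵥ x = 0 := by
  set S := ∑ i : Fin m, x i.succ ^ 2 with hS
  have hxS : x 0 ^ 2 < S := sub_neg.1 hx
  refine ⟨Fin.cons S fun i => -(x 0 * x i.succ), ?_, ?_⟩
  · have hform : lorentzForm (Fin.cons S fun i => -(x 0 * x i.succ) : Fin (m + 1) → ℝ) =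
        S * (S - x 0 ^ 2) := by
      simp only [lorentzForm, Fin.cons_zero, Fin.cons_succ, neg_sq, mul_pow, ← Finset.mul_sum, ← hS]
      ring
    rw [hform]
    exact mul_pos ((sq_nonneg _).trans_lt hxS) (sub_pos.2 hxS)
  · simp only [dotProduct, Fin.sum_univ_succ, Fin.cons_zero, Fin.cons_succ, hS, Finset.sum_mul]
    rw [← Finset.sum_add_distrib]
    exact Finset.sum_eq_zero fun i _ => by ring

theorem mem_secondOrderCone_iff :
    x ∈ secondOrderCone m ↔ 0 ≤ x 0 ∧ 0 ≤ lorentzForm x := by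
  rw [lorentzForm, sub_nonneg]
  exact Real.sqrt_le_iff

theorem mem_secondOrderCone_union_neg_iff :
    x ∈ secondOrderCone m ∪ -secondOrderCone m ↔ 0 ≤ lorentzForm x := by
  simp only [Set.mem_union, Set.mem_neg, mem_secondOrderCone_iff, lorentzForm_neg, Pi.neg_apply,
    Left.nonneg_neg_iff, ← or_and_right, le_total, true_and]

theorem mem_closure_compl_secondOrderCone (hx : x 0 = √(∑ i : Fin m, x i.succ ^ 2)) :
    x ∈ closure (secondOrderCone m)ᶜ := by
  have hlim : Filter.Tendsto (fun s => Function.update x 0 s) (nhdsWithin (x 0) (Set.Iio (x 0)))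
      (nhds x) := by
    have hcont : Continuous fun s => Function.update x 0 s := by fun_prop
    simpa using (hcont.tendsto (x 0)).mono_left nhdsWithin_le_nhds
  refine mem_closure_of_tendsto hlim (Filter.eventually_of_mem self_mem_nhdsWithin ?_)
  intro s hs
  simpa [secondOrderCone, ← hx] using hs

theorem mem_frontier_secondOrderCone_iff :
    x ∈ frontier (secondOrderCone m) ↔ 0 ≤ x 0 ∧ lorentzForm x = 0 := by
  have hsqrt : √(∑ i : Fin m, x i.succ ^ 2) = x 0 ↔ 0 ≤ x 0 ∧ lorentzForm x = 0 := by
    refine ⟨fun h => ⟨h ▸ Real.sqrt_nonneg _, ?_⟩, fun ⟨h0, h⟩ => ?_⟩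
    · rw [lorentzForm, ← h, Real.sq_sqrt (Finset.sum_nonneg fun i _ => sq_nonneg _), sub_self]
    · rw [← sub_eq_zero.1 h, Real.sqrt_sq h0]
  rw [← hsqrt]
  refine ⟨fun h => ?_, fun h => ?_⟩
  · exact frontier_le_subset_eq
      (f := fun x : Fin (m + 1) → ℝ => √(∑ i : Fin m, x i.succ ^ 2)) (by fun_prop)
      (continuous_apply 0) h
  · rw [frontier_eq_closure_inter_closure]
    exact ⟨subset_closure h.le, mem_closure_compl_secondOrderCone h.symm⟩

theorem exists_mem_frontier_symSquare_eq (hx0 : x ≠ 0) (hx : lorentzForm x = 0) :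
    ∃ y ∈ frontier (secondOrderCone m) \ {0}, symSquare y = symSquare x := by
  rcases le_total 0 (x 0) with h0 | h0
  · exact ⟨x, ⟨mem_frontier_secondOrderCone_iff.2 ⟨h0, hx⟩, hx0⟩, rfl⟩
  · exact ⟨-x, ⟨mem_frontier_secondOrderCone_iff.2 ⟨neg_nonneg.2 h0, by rwa [lorentzForm_neg]⟩,
      neg_ne_zero.2 hx0⟩, symSquare_neg x⟩

end Lorentz

section Copositive

open Matrix

variable {m : ℕ} {x : Fin (m + 1) → ℝ}

theorem symJ_mem_copositiveCone : symJ m ∈ copositiveCone (secondOrderCone m) := fun x hx => by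
  rw [dotProduct_symJ_mulVec]
  exact (mem_secondOrderCone_iff.1 hx).2

theorem symSquare_sub_lorentzForm_smul_symJ_mem_copositiveCone (v : Fin (m + 1) → ℝ) :
    symSquare v - lorentzForm v • symJ m ∈ copositiveCone (secondOrderCone m) := by
  intro x hx
  have hform : x ⬝ᵥ (symSquare v - lorentzForm v • symJ m).1 *ᵥ x =
      (x ⬝ᵥ v) ^ 2 - lorentzForm x * lorentzForm v := by
    simp only [Submodule.coe_sub, SetLike.val_smul, sub_mulVec, smul_mulVec, dotProduct_sub,
      dotProduct_smul, dotProduct_symSquare_mulVec, dotProduct_symJ_mulVec, smul_eq_mul,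
      dotProduct_comm v, mul_comm (lorentzForm v)]
  rw [hform, sub_nonneg]
  exact lorentzForm_mul_le_dotProduct_sq (mem_secondOrderCone_iff.1 hx).2 v

theorem copositiveCone_secondOrderCone_eq_sup :
    copositiveCone (secondOrderCone m) = rayCone (symJ m) ⊔ copositiveCone Set.univ := by
  refine le_antisymm (fun A hA => ?_)
    (sup_le (rayCone_le_iff.2 symJ_mem_copositiveCone) (copositiveCone_anti (Set.subset_univ _)))
  have hform : ∀ (B : symMat (m + 1)) x, B.1.toQuadraticForm' x = x ⬝ᵥ B.1 *ᵥ x := fun B x => by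
    simp [toQuadraticForm', toLinearMap₂'_apply']
  have hJ : ∃ x, 0 < (symJ m).1.toQuadraticForm' x :=
    ⟨Pi.single 0 1, by rw [hform, dotProduct_symJ_mulVec]; simp [lorentzForm]⟩
  have hAJ : ∀ x, 0 ≤ (symJ m).1.toQuadraticForm' x → 0 ≤ A.1.toQuadraticForm' x := fun x hx => by
    rw [hform, dotProduct_symJ_mulVec, ← mem_secondOrderCone_union_neg_iff] at hx
    rw [hform]
    rcases hx with hx | hx
    · exact hA x hx
    · simpa [mulVec_neg] using hA (-x) hx
  obtain ⟨t, ht, hle⟩ := exists_forall_mul_le_of_forall_nonneg_imp_nonneg hJ hAJ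
  refine Submodule.mem_sup.2 ⟨t • symJ m, ⟨t, ht, rfl⟩, A - t • symJ m, fun x _ => ?_,
    add_sub_cancel _ _⟩
  have hx := hle x
  rw [hform, hform, ← sub_nonneg] at hx
  simpa [sub_mulVec, smul_mulVec, dotProduct_sub, dotProduct_smul] using hx

theorem copositiveCone_secondOrderCone_eq_hull :
    copositiveCone (secondOrderCone m) =
      PointedCone.hull ℝ (insert (symJ m) (Set.range symSquare)) := by
  rw [copositiveCone_secondOrderCone_eq_sup, rayCone_eq_hull, copositiveCone_univ_eq_hull,
    PointedCone.hull, PointedCone.hull, PointedCone.hull, Submodule.span_insert]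

/-- The diagonal matrix `diag(c, 1, …, 1)`. Its pairings with the generators of the copositive cone
expose the ray of `J` for `c = m` and show that the cone is salient for `c = m + 1`. -/
def timeDiag (m : ℕ) (c : ℝ) : symMat (m + 1) :=
  ⟨diagonal (Fin.cons c fun _ => 1), isSymm_diagonal _⟩

theorem symInner_timeDiag_symJ (c : ℝ) : symInner (m + 1) (timeDiag m c) (symJ m) = c - m := by
  simp [symInner, timeDiag, symJ, diagonal_apply, Fin.sum_univ_succ, (Fin.succ_ne_zero _).symm,
    sub_eq_add_neg]

theorem symInner_timeDiag_symSquare_pos {c : ℝ} (hc : 0 < c) (hx : x ≠ 0) :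
    0 < symInner (m + 1) (timeDiag m c) (symSquare x) := by
  have hpos : (timeDiag m c).1.PosDef := by
    refine PosDef.diagonal fun i => ?_
    cases i using Fin.cases <;> simp [hc]
  rw [symInner_symSquare]
  simpa using hpos.dotProduct_mulVec_pos hx

theorem lineal_copositiveCone_secondOrderCone :
    (copositiveCone (secondOrderCone m)).lineal = ⊥ := by
  rw [copositiveCone_secondOrderCone_eq_hull]
  refine lineal_hull_eq_bot (ℓ := symInner (m + 1) (timeDiag m (m + 1))) ?_
  rintro _ (rfl | ⟨v, rfl⟩) h0
  · rw [symInner_timeDiag_symJ, add_sub_cancel_left]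
    exact one_pos
  · refine symInner_timeDiag_symSquare_pos (by positivity) ?_
    rintro rfl
    exact h0 symSquare_zero

theorem isExposedFace_rayCone_symJ (hm : 1 ≤ m) :
    IsExposedFace (symInner (m + 1)) (rayCone (symJ m)) (copositiveCone (secondOrderCone m)) := by
  have hJ : symInner (m + 1) (timeDiag m m) (symJ m) = 0 := by
    rw [symInner_timeDiag_symJ, sub_self]
  have hpos : ∀ {v : Fin (m + 1) → ℝ}, v ≠ 0 →
      0 < symInner (m + 1) (timeDiag m m) (symSquare v) :=
    symInner_timeDiag_symSquare_pos (Nat.cast_pos.2 hm)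
  rw [copositiveCone_secondOrderCone_eq_hull]
  refine isExposedFace_rayCone_hull symInner_isSymm (Set.mem_insert _ _) hJ ?_ ?_
  · rintro _ (rfl | ⟨v, rfl⟩)
    · exact hJ.ge
    · rcases eq_or_ne v 0 with rfl | hv
      · rw [symSquare_zero, map_zero]
      · exact (hpos hv).le
  · rintro _ (rfl | ⟨v, rfl⟩) h0
    · exact self_mem_rayCone _
    · rcases eq_or_ne v 0 with rfl | hv
      · exact symSquare_zero ▸ Submodule.zero_mem _
      · exact absurd h0 (hpos hv).ne'

theorem isExposedFace_rayCone_symSquare_of_lorentzForm_neg (hx : lorentzForm x < 0) :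
    IsExposedFace (symInner (m + 1)) (rayCone (symSquare x))
      (copositiveCone (secondOrderCone m)) := by
  have hx0 : x ≠ 0 := by
    rintro rfl
    exact hx.ne lorentzForm_zero
  obtain ⟨y, hy, hyx⟩ := exists_lorentzForm_pos_of_lorentzForm_neg hx
  obtain ⟨r, hr0, hr⟩ : ∃ r : ℝ, 0 ≤ r ∧
      0 < r * lorentzForm y + symInner (m + 1) (orthProjMat x) (symJ m) := by
    refine ⟨(|symInner (m + 1) (orthProjMat x) (symJ m)| + 1) / lorentzForm y, by positivity, ?_⟩
    rw [div_mul_cancel₀ _ hy.ne']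
    linarith [neg_abs_le (symInner (m + 1) (orthProjMat x) (symJ m))]
  set H : symMat (m + 1) := r • symSquare y + orthProjMat x with hH
  have hHJ : 0 < symInner (m + 1) H (symJ m) := by
    rwa [hH, map_add, map_smul, LinearMap.add_apply, LinearMap.smul_apply,
      ← symInner_isSymm.eq (symJ m), RingHom.id_apply, symInner_symSquare,
      dotProduct_symJ_mulVec, smul_eq_mul]
  have hHsq : ∀ v, symInner (m + 1) H (symSquare v) =
      r * (y ⬝ᵥ v) ^ 2 + symInner (m + 1) (orthProjMat x) (symSquare v) := fun v => by
    rw [hH, map_add, map_smul, LinearMap.add_apply, LinearMap.smul_apply, symInner_symSquare,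
      dotProduct_symSquare_mulVec, smul_eq_mul]
  have hsq : ∀ v, 0 ≤ r * (y ⬝ᵥ v) ^ 2 := fun v => by positivity
  rw [copositiveCone_secondOrderCone_eq_hull]
  refine isExposedFace_rayCone_hull (H := H) symInner_isSymm
    (Set.mem_insert_of_mem _ (Set.mem_range_self x)) ?_ ?_ ?_
  · rw [hHsq, hyx, symInner_orthProjMat_symSquare_self]
    ring
  · rintro _ (rfl | ⟨v, rfl⟩)
    · exact hHJ.le
    · rw [hHsq]
      exact add_nonneg (hsq v) (symInner_orthProjMat_symSquare_nonneg x v)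
  · rintro _ (rfl | ⟨v, rfl⟩) h0
    · exact absurd h0 hHJ.ne'
    · rw [hHsq, add_eq_zero_iff_of_nonneg (hsq v) (symInner_orthProjMat_symSquare_nonneg x v)] at h0
      exact symSquare_mem_rayCone_of_symInner_orthProjMat_eq_zero hx0 h0.2

theorem eq_zero_of_sub_smul_symJ_mem_copositiveCone_univ {M : symMat (m + 1)} {t : ℝ}
    (hM : M - t • symJ m ∈ copositiveCone Set.univ) (hx0 : x ≠ 0) (hx : lorentzForm x = 0)
    (hMx : M.1 *ᵥ x = 0) : t = 0 := by
  have hmulVec : (M - t • symJ m).1 *ᵥ x = -(t • (symJ m).1 *ᵥ x) := by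
    simp [sub_mulVec, smul_mulVec, hMx]
  have hker := mulVec_eq_zero_of_mem_copositiveCone_univ hM (x := x) (by
    rw [hmulVec, dotProduct_neg, dotProduct_smul, dotProduct_symJ_mulVec, hx, smul_zero, neg_zero])
  rw [hmulVec, neg_eq_zero] at hker
  exact (smul_eq_zero.1 hker).resolve_right (symJ_mulVec_ne_zero hx0)

theorem eq_zero_of_smul_symSquare_sub_smul_symJ_mem_copositiveCone_univ {c t : ℝ} (hx0 : x ≠ 0)
    (hx : lorentzForm x = 0) (h : c • symSquare x - t • symJ m ∈ copositiveCone Set.univ) :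
    t = 0 := by
  refine eq_zero_of_sub_smul_symJ_mem_copositiveCone_univ h (symJ_mulVec_ne_zero hx0)
    (by rwa [lorentzForm_symJ_mulVec]) ?_
  rw [SetLike.val_smul, smul_mulVec, symSquare_mulVec, dotProduct_symJ_mulVec, hx, zero_smul,
    smul_zero]

theorem isFaceOf_rayCone_symSquare_of_lorentzForm_eq_zero (hx0 : x ≠ 0) (hx : lorentzForm x = 0) :
    (rayCone (symSquare x)).IsFaceOf (copositiveCone (secondOrderCone m)) := by
  rw [copositiveCone_secondOrderCone_eq_sup]
  refine isFaceOf_rayCone_sup (isExposedFace_rayCone_symSquare_copositiveCone_univ hx0).1 ?_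
  rintro t - P hP ⟨c, -, hc⟩
  refine eq_zero_of_smul_symSquare_sub_smul_symJ_mem_copositiveCone_univ (c := c) hx0 hx ?_
  rwa [← hc, add_sub_cancel_left]

theorem sub_symInner_smul_symJ_mem_copositiveCone_univ {H : symMat (m + 1)}
    (hH : ∀ A ∈ copositiveCone (secondOrderCone m), 0 ≤ symInner (m + 1) H A) :
    H - symInner (m + 1) H (symJ m) • symJ m ∈ copositiveCone Set.univ := by
  intro v _
  have hv := hH _ (symSquare_sub_lorentzForm_smul_symJ_mem_copositiveCone v)
  rw [map_sub, map_smul, symInner_symSquare] at hv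
  simpa [sub_mulVec, smul_mulVec, dotProduct_symJ_mulVec, mul_comm] using hv

theorem not_isExposedFace_rayCone_symSquare_of_lorentzForm_eq_zero (hx0 : x ≠ 0)
    (hx : lorentzForm x = 0) :
    ¬ IsExposedFace (symInner (m + 1)) (rayCone (symSquare x))
      (copositiveCone (secondOrderCone m)) := by
  rintro ⟨-, H, hdual, hexp⟩
  have hH : ∀ A ∈ copositiveCone (secondOrderCone m), 0 ≤ symInner (m + 1) H A := fun A hA =>
    (symInner_isSymm.eq A H).symm ▸ hdual hA
  have hmem : ∀ A, A ∈ rayCone (symSquare x) ↔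
      symInner (m + 1) H A = 0 ∧ A ∈ copositiveCone (secondOrderCone m) := Set.ext_iff.1 hexp
  have hHx : H.1 *ᵥ x = 0 := by
    refine mulVec_eq_zero_of_mem_copositiveCone_univ (fun v _ => ?_) ?_
    · rw [← symInner_symSquare]
      exact hH _ (symSquare_mem_copositiveCone _ v)
    · rw [← symInner_symSquare]
      exact ((hmem _).1 (self_mem_rayCone _)).1
  have hHJ : symInner (m + 1) H (symJ m) = 0 :=
    eq_zero_of_sub_smul_symJ_mem_copositiveCone_univ
      (sub_symInner_smul_symJ_mem_copositiveCone_univ hH) hx0 hx hHx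
  obtain ⟨α, -, hα⟩ := (hmem _).2 ⟨hHJ, symJ_mem_copositiveCone⟩
  have hzero : α • symSquare x - (1 : ℝ) • symJ m ∈ copositiveCone Set.univ := by
    rw [one_smul, ← hα, sub_self]
    exact Submodule.zero_mem _
  exact one_ne_zero
    (eq_zero_of_smul_symSquare_sub_smul_symJ_mem_copositiveCone_univ hx0 hx hzero)

theorem IsExtremeRay.eq_rayCone_symJ_or_symSquare {R : PointedCone ℝ (symMat (m + 1))}
    (hR : IsExtremeRay R (copositiveCone (secondOrderCone m))) :
    R = rayCone (symJ m) ∨ ∃ x, x ≠ 0 ∧ lorentzForm x ≤ 0 ∧ R = rayCone (symSquare x) := by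
  have hgen : ∀ {A}, A ∈ R → A ≠ 0 → R = rayCone A :=
    hR.eq_rayCone lineal_copositiveCone_secondOrderCone
  obtain ⟨A, hA, hA0⟩ := hR.exists_ne_zero
  obtain ⟨_, rfl | ⟨x, rfl⟩, hsR, hs0⟩ := exists_ne_zero_generator_mem_of_isFaceOf_hull
    (copositiveCone_secondOrderCone_eq_hull (m := m) ▸ hR.1) hA hA0
  · exact Or.inl (hgen hsR hs0)
  rcases le_or_gt (lorentzForm x) 0 with hx | hx
  · refine Or.inr ⟨x, ?_, hx, hgen hsR hs0⟩
    rintro rfl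
    exact hs0 symSquare_zero
  · have hJR : symJ m ∈ R := hR.1.mem_of_smul_add_mem symJ_mem_copositiveCone
      (symSquare_sub_lorentzForm_smul_symJ_mem_copositiveCone x) hx (by rwa [add_sub_cancel])
    exact Or.inl (hgen hJR symJ_ne_zero)

theorem isExtremeRay_copositiveCone_secondOrderCone_iff (hm : 1 ≤ m)
    {R : PointedCone ℝ (symMat (m + 1))} :
    IsExtremeRay R (copositiveCone (secondOrderCone m)) ↔
      R = rayCone (symJ m) ∨ ∃ x, x ≠ 0 ∧ lorentzForm x ≤ 0 ∧ R = rayCone (symSquare x) := by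
  refine ⟨IsExtremeRay.eq_rayCone_symJ_or_symSquare, ?_⟩
  rintro (rfl | ⟨x, hx0, hx, rfl⟩)
  · exact isExtremeRay_rayCone (isExposedFace_rayCone_symJ hm).1 symJ_ne_zero
  · refine isExtremeRay_rayCone ?_ (symSquare_ne_zero hx0)
    rcases hx.lt_or_eq with hx | hx
    · exact (isExposedFace_rayCone_symSquare_of_lorentzForm_neg hx).1
    · exact isFaceOf_rayCone_symSquare_of_lorentzForm_eq_zero hx0 hx

end Copositive

theorem mainTheorem4 (m : ℕ) (hm : 1 ≤ m) :
    (∀ R : PointedCone ℝ (symMat (m + 1)),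
      IsExtremeRay R (copositiveCone (secondOrderCone m)) ↔
        (∃ x : Fin (m + 1) → ℝ, x ∉ secondOrderCone m ∪ -secondOrderCone m ∧
          R = rayCone (symSquare x)) ∨
        R = rayCone (symJ m) ∨
        (∃ x : Fin (m + 1) → ℝ, x ∈ frontier (secondOrderCone m) \ {0} ∧
          R = rayCone (symSquare x))) ∧
    (∀ x : Fin (m + 1) → ℝ, x ∉ secondOrderCone m ∪ -secondOrderCone m →
      IsExposedFace (symInner (m + 1)) (rayCone (symSquare x))
        (copositiveCone (secondOrderCone m))) ∧
    IsExposedFace (symInner (m + 1)) (rayCone (symJ m)) (copositiveCone (secondOrderCone m)) ∧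
    (∀ x : Fin (m + 1) → ℝ, x ∈ frontier (secondOrderCone m) \ {0} →
      ¬ IsExposedFace (symInner (m + 1)) (rayCone (symSquare x))
        (copositiveCone (secondOrderCone m))) := by
  have hfrontier : ∀ x : Fin (m + 1) → ℝ, x ∈ frontier (secondOrderCone m) \ {0} →
      x ≠ 0 ∧ lorentzForm x = 0 :=
    fun x hx => ⟨hx.2, (mem_frontier_secondOrderCone_iff.1 hx.1).2⟩
  simp only [mem_secondOrderCone_union_neg_iff, not_le]
  refine ⟨fun R => ?_, fun x => isExposedFace_rayCone_symSquare_of_lorentzForm_neg,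
    isExposedFace_rayCone_symJ hm, fun x hx =>
      not_isExposedFace_rayCone_symSquare_of_lorentzForm_eq_zero (hfrontier x hx).1
        (hfrontier x hx).2⟩
  rw [isExtremeRay_copositiveCone_secondOrderCone_iff hm]
  constructor
  · rintro (hJ | ⟨x, hx0, hx, rfl⟩)
    · exact Or.inr (Or.inl hJ)
    rcases hx.lt_or_eq with hx | hx
    · exact Or.inl ⟨x, hx, rfl⟩
    · obtain ⟨y, hy, hyx⟩ := exists_mem_frontier_symSquare_eq hx0 hx
      exact Or.inr (Or.inr ⟨y, hy, by rw [hyx]⟩)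
  · rintro (⟨x, hx, rfl⟩ | hJ | ⟨x, hx, rfl⟩)
    · exact Or.inr ⟨x, fun h => hx.ne (h ▸ lorentzForm_zero), hx.le, rfl⟩
    · exact Or.inl hJ
    · exact Or.inr ⟨x, (hfrontier x hx).1, (hfrontier x hx).2.le, rfl⟩
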